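/- Let $k$ be a field, let $A'$ be a finitely generated $k$-algebra and domain, and let $\nu':A'\setminus\{0\}\to\mathbb{Z}^r$ be a valuation (min-convention, $\mathbb{Z}^r$ with a total group order $\prec$) that lifts the trivial valuation on $k^\times$, whose image is maximum-well-ordered, and which has one-dimensional leaves. Let $A=\bigoplus_{i\ge 0}A_i$ be a graded $k$-algebra with pieces $A_i\subseteq A'$ and the multiplication of $A'$, and let $\nu:A\setminus\{0\}\to\mathbb{N}\times\mathbb{Z}^r$, $\nu(f)=(s,\nu'(f_s))$ with $f_s\neq 0$ the component of $f$ of largest degree, where $(s,a)\succ(t,b)$ iff $s<t$, or $s=t$ and $a\succ b$. Let $\{g_1,\dots,g_m\}$ be a finite Khovanskii basis of $A$ with respect to $\nu$ (the classes of the $g_i$ generate $\operatorname{gr}_\nu(A)$ as an algebra) consisting of homogeneous elements of positive degrees $d_i=\deg g_i$, and put $\vec d=(d_1,\dots,d_m)$. Let $R=k[x_1,\dots,x_m]$, let $\pi:R\to A$, $\pi(x_i)=g_i$, let $I=\ker\pi$, and grade $R/I$ by $\deg x_i=d_i$. Let $<$ be a monomial order on $R$ induced by $\nu$: $x^\alpha>x^\beta$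 iff $\nu(\pi(x^\alpha))\prec\nu(\pi(x^\beta))$, or these values are equal and $x^\alpha>'x^\beta$ for a fixed tie-breaking monomial order $<'$. For a polynomial $f\in I$ with at least two terms and two largest monomials $x^{\alpha_1}>x^{\alpha_2}$ put $\operatorname{torexp}(f)=\alpha_1-\alpha_2$, let $K\subseteq\mathbb{Z}^m$ be the lattice generated by all these toric exponents, and let $\ell$ be its rank. For $[f]\in R/I$ nonzero, let $\mu([f])$ be the image of $-\alpha$ in $(\mathbb{Z}^m/K)/\mathrm{torsion}$, where $x^\alpha$ is the leading monomial of the normal form of $f$ with respect to $I$ and $<$. Call a basis $\vec w_1,\dots,\vec w_m$ of $\mathbb{Q}^m$ adapted to $K$ and $\vec d$ if $\vec w_1,\dots,\vec w_\ell$ is a lattice basis of $K$, $\vec w_{\ell+1}=\vec d$, and $\vec w_{\ell+2},\dots,\vec w_m\in\mathbb{Z}^m$ are orthogonal to $\vec d$. Such a basis is used to represent $\mu$ as a map to $\mathbb{Q}^{m-\ell}\subseteq\mathbb{R}^{m-\ell}$: the class of $-\alpha$ is represented by the coordinates of $\alpha$ with respect to $\vec w_{\ell+1},\dots,\vec w_m$,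 and $\mu([f])_1$ denotes the first of these coordinates. Then, if $m\ge1$, adapted bases exist, and for every adapted basis $\mu([x_i])_1\ne 0$ for all $i$, and the Newton–Okounkov body $$\Delta(R/I,\mu)=\overline{\operatorname{conv}\{\mu([f])/i \;:\; i>0,\ [f]\in (R/I)_i\setminus\{0\}\}}$$ is given by $$\Delta(R/I,\mu)=\operatorname{conv}\left\{\frac{\mu([x_i])}{\|\vec d\|^2\,\mu([x_i])_1}\;:\;1\le i\le m\right\}.$$ -/

import Mathlib

open scoped Polynomial

noncomputable section

namespace KhovanskiiBasis

/-! ### Valued algebras -/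

/-- A valuation `ν : A ∖ {0} → Γ` on a `k`-algebra `A` (min-convention, extended by `ν 0 = ⊤`)
that lifts the trivial valuation on `k ∖ {0}`. -/
structure AlgVal (k A Γ : Type*) [Field k] [CommRing A] [Algebra k A]
    [AddCancelCommMonoid Γ] [LinearOrder Γ] [IsOrderedAddMonoid Γ] where
  val : AddValuation A (WithTop Γ)
  eq_zero_of_val_eq_top : ∀ f : A, val f = ⊤ → f = 0
  val_algebraMap : ∀ c : k, c ≠ 0 → val (algebraMap k A c) = 0

namespace AlgVal

section

variable {k A Γ : Type*} [Field k] [CommRing A] [Algebra k A]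
  [AddCancelCommMonoid Γ] [LinearOrder Γ] [IsOrderedAddMonoid Γ] (ν : AlgVal k A Γ)

theorem val_eq_top_iff (f : A) : ν.val f = ⊤ ↔ f = 0 :=
  ⟨ν.eq_zero_of_val_eq_top f, fun h => by rw [h]; exact ν.val.map_zero⟩

theorem val_smul (c : k) (hc : c ≠ 0) (f : A) : ν.val (c • f) = ν.val f := by
  rw [Algebra.smul_def, AddValuation.map_mul, ν.val_algebraMap c hc, zero_add]

/-- `F_{⪰ a} = {f : ν f ⪰ a} ∪ {0}`. -/
def filtGE (a : Γ) : Submodule k A where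
  carrier := {f | (a : WithTop Γ) ≤ ν.val f}
  add_mem' := fun {_ _} hf hg => ν.val.map_le_add hf hg
  zero_mem' := by
    change _ ≤ ν.val 0
    rw [ν.val.map_zero]
    exact le_top
  smul_mem' := fun c f hf => by
    by_cases hc : c = 0
    · change _ ≤ ν.val _
      rw [hc, zero_smul, ν.val.map_zero]
      exact le_top
    · change _ ≤ ν.val _
      rw [ν.val_smul c hc]
      exact hf

/-- `F_{≻ a} = {f : ν f ≻ a} ∪ {0}`. -/
def filtGT (a : Γ) : Submodule k A where
  carrier := {f | (a : WithTop Γ) < ν.val f}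
  add_mem' := fun {_ _} hf hg => ν.val.map_lt_add hf hg
  zero_mem' := by
    change _ < ν.val 0
    rw [ν.val.map_zero]
    exact WithTop.coe_lt_top a
  smul_mem' := fun c f hf => by
    by_cases hc : c = 0
    · change _ < ν.val _
      rw [hc, zero_smul, ν.val.map_zero]
      exact WithTop.coe_lt_top a
    · change _ < ν.val _
      rw [ν.val_smul c hc]
      exact hf

theorem mem_filtGE (a : Γ) (f : A) : f ∈ ν.filtGE a ↔ (a : WithTop Γ) ≤ ν.val f := Iff.rfl

theorem mem_filtGT (a : Γ) (f : A) : f ∈ ν.filtGT a ↔ (a : WithTop Γ) < ν.val f := Iff.rfl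

/-- The standing hypotheses on a valued algebra. (That `ν` lifts the trivial valuation of `k` is
part of `AlgVal`.) -/
structure StandingHypotheses : Prop where
  isDomain : IsDomain A
  finiteType : Algebra.FiniteType k A
  /-- Every nonempty subset of the image of `ν` has a maximum. -/
  maxWellOrdered : ∀ S : Set Γ, S.Nonempty → (∀ a ∈ S, ∃ f : A, ν.val f = a) →
    ∃ a ∈ S, ∀ b ∈ S, b ≤ a
  /-- One-dimensional leaves: `dim_k F_{⪰ a} / F_{≻ a} ≤ 1` for all `a`. -/
  oneDimLeaves : ∀ a : Γ,
    Module.rank k (ν.filtGE a ⧸ (ν.filtGT a).submoduleOf (ν.filtGE a)) ≤ 1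

theorem mul_mem_filtGE {a b : Γ} {f g : A} (hf : f ∈ ν.filtGE a) (hg : g ∈ ν.filtGE b) :
    f * g ∈ ν.filtGE (a + b) := by
  rw [mem_filtGE] at hf hg ⊢
  rw [AddValuation.map_mul, WithTop.coe_add]
  exact add_le_add hf hg

theorem mul_mem_filtGT {a b : Γ} {f g : A} (hf : f ∈ ν.filtGE a) (hg : g ∈ ν.filtGT b) :
    f * g ∈ ν.filtGT (a + b) := by
  rw [mem_filtGE] at hf
  rw [mem_filtGT] at hg ⊢
  rw [AddValuation.map_mul, WithTop.coe_add]
  exact WithTop.add_lt_add_of_le_of_lt (WithTop.coe_ne_top) hf hg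

theorem coeff_mul_mem (F : Γ → Submodule k A) (x y : AddMonoidAlgebra A Γ)
    (h : ∀ a b, x.coeff a * y.coeff b ∈ F (a + b)) (c : Γ) : (x * y).coeff c ∈ F c := by
  rw [AddMonoidAlgebra.mul_def, Finsupp.sum, AddMonoidAlgebra.coeff_sum, Finsupp.finsetSum_apply]
  refine sum_mem fun a _ => ?_
  rw [Finsupp.sum, AddMonoidAlgebra.coeff_sum, Finsupp.finsetSum_apply]
  refine sum_mem fun b _ => ?_
  rw [AddMonoidAlgebra.coeff_single, Finsupp.single_apply]
  split_ifs with hab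
  · rw [← hab]
    exact h a b
  · exact zero_mem _

/-- The graded algebra `⨁ a, F_{⪰ a}`, realized as the algebra of the finite sums `∑ f_a t^a` with
`f_a ∈ F_{⪰ a}` inside the group algebra `A[Γ]`. -/
def filtAlgebra : Subalgebra k (AddMonoidAlgebra A Γ) where
  carrier := {x | ∀ a, x.coeff a ∈ ν.filtGE a}
  add_mem' := fun {x y} hx hy a => by
    rw [AddMonoidAlgebra.coeff_add, Finsupp.add_apply]
    exact add_mem (hx a) (hy a)
  mul_mem' := fun {x y} hx hy c =>
    coeff_mul_mem ν.filtGE x y (fun a b => ν.mul_mem_filtGE (hx a) (hy b)) c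
  algebraMap_mem' := fun c a => by
    classical
    rw [AddMonoidAlgebra.coe_algebraMap, Function.comp_apply, AddMonoidAlgebra.coeff_single,
      Finsupp.single_apply]
    split_ifs with h
    · rw [← h, Algebra.algebraMap_eq_smul_one]
      refine Submodule.smul_mem _ _ ?_
      rw [mem_filtGE, ν.val.map_one]
      exact le_refl _
    · exact zero_mem _

theorem mem_filtAlgebra (x : AddMonoidAlgebra A Γ) :
    x ∈ ν.filtAlgebra ↔ ∀ a, x.coeff a ∈ ν.filtGE a := Iff.rfl

/-- The ideal `⨁ a, F_{≻ a}` of `⨁ a, F_{⪰ a}`. -/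
def gtIdeal : Ideal ν.filtAlgebra where
  carrier := {x | ∀ a, (x : AddMonoidAlgebra A Γ).coeff a ∈ ν.filtGT a}
  add_mem' := fun {x y} hx hy a => by
    rw [Subalgebra.coe_add, AddMonoidAlgebra.coeff_add, Finsupp.add_apply]
    exact add_mem (hx a) (hy a)
  zero_mem' := fun a => zero_mem (ν.filtGT a)
  smul_mem' := fun x y hy c =>
    coeff_mul_mem ν.filtGT x y (fun a b => ν.mul_mem_filtGT (x.2 a) (hy b)) c

/-- The associated graded algebra `gr_ν(A) = ⨁ a, F_{⪰ a} / F_{≻ a}`, as the quotient of the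
algebra `⨁ a, F_{⪰ a}` by its ideal `⨁ a, F_{≻ a}`. -/
abbrev Gr : Type _ := ν.filtAlgebra ⧸ ν.gtIdeal

/-- The image `f + F_{≻ a}` in `gr_ν(A)` of an element `f` of `F_{⪰ a}`. -/
def toGr (a : Γ) (f : ν.filtGE a) : ν.Gr :=
  Ideal.Quotient.mk ν.gtIdeal ⟨AddMonoidAlgebra.single a (f : A), by
    classical
    rw [mem_filtAlgebra]
    intro b
    rw [AddMonoidAlgebra.coeff_single, Finsupp.single_apply]
    split_ifs with h
    · rw [← h]
      exact f.2
    · exact zero_mem _⟩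

/-- The value `ν f` of a nonzero element, as an element of `Γ`. -/
def value (f : A) (hf : f ≠ 0) : Γ :=
  (ν.val f).untop fun h => hf (ν.eq_zero_of_val_eq_top f h)

theorem coe_value (f : A) (hf : f ≠ 0) : (ν.value f hf : WithTop Γ) = ν.val f :=
  WithTop.coe_untop _ _

/-- The class `f + F_{≻ ν f}` of a nonzero `f` in `gr_ν(A)`. -/
def initialForm (f : A) (hf : f ≠ 0) : ν.Gr :=
  ν.toGr (ν.value f hf) ⟨f, (ν.mem_filtGE _ _).2 (ν.coe_value f hf).le⟩

/-- `g` is a Khovanskii basis of `A`: its members are nonzero and their classes generate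
`gr_ν(A)` as a `k`-algebra. -/
def IsKhovanskiiBasis {ι : Type*} (g : ι → A) : Prop :=
  ∃ hg : ∀ i, g i ≠ 0,
    Algebra.adjoin k (Set.range fun i => ν.initialForm (g i) (hg i)) = ⊤

end

end AlgVal

/-! ### Graded algebras `A = ⨁ Aᵢ` with `Aᵢ ⊆ A'` and the valuation induced on them -/

section Graded

variable {k A' Γ : Type*} [Field k] [CommRing A'] [Algebra k A']

/-- The graded algebra `A = ⨁ i, Aᵢ` with pieces `Aᵢ ⊆ A'`, realized as the algebra
`⨁ i, Aᵢ tⁱ ⊆ A'[t]`. -/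
def gradedAlgebra (𝒜 : ℕ → Submodule k A') [SetLike.GradedMonoid 𝒜] : Subalgebra k A'[X] where
  carrier := {f | ∀ i, f.coeff i ∈ 𝒜 i}
  add_mem' := fun {f g} hf hg i => by
    rw [Polynomial.coeff_add]
    exact add_mem (hf i) (hg i)
  mul_mem' := fun {f g} hf hg i => by
    rw [Polynomial.coeff_mul]
    refine sum_mem fun x hx => ?_
    rw [← Finset.HasAntidiagonal.mem_antidiagonal.1 hx]
    exact SetLike.mul_mem_graded (hf x.1) (hg x.2)
  algebraMap_mem' := fun c i => by
    rw [Polynomial.algebraMap_apply, Polynomial.coeff_C]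
    split_ifs with h
    · rw [h, Algebra.algebraMap_eq_smul_one]
      exact Submodule.smul_mem _ _ SetLike.GradedOne.one_mem
    · exact zero_mem _

/-- `f` is homogeneous of degree `i`, i.e. it lies in the summand `Aᵢ = Aᵢ tⁱ`. -/
def IsHomogeneousOfDegree (𝒜 : ℕ → Submodule k A') [SetLike.GradedMonoid 𝒜] (i : ℕ)
    (f : gradedAlgebra 𝒜) : Prop :=
  ∃ c ∈ 𝒜 i, (f : A'[X]) = Polynomial.monomial i c

variable [AddCommGroup Γ] [LinearOrder Γ] [IsOrderedAddMonoid Γ]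

/-- The value group `ℕ × Γ`, ordered by `(m, a) ≻ (n, b)` iff `m < n`, or `m = n` and `a ≻ b`. -/
abbrev DegValue (Γ : Type*) : Type _ := ℕᵒᵈ ×ₗ Γ

/-- The pair `(m, a)` in `ℕ × Γ`. -/
def degPair (m : ℕ) (a : Γ) : DegValue Γ := toLex (OrderDual.toDual m, a)

/-- `ν(∑ fᵢ tⁱ) = (m, ν'(f_m))` with `m` the largest index such that `f_m ≠ 0`; and `ν(0) = ⊤`. -/
def degValFun (ν' : AlgVal k A' Γ) (f : A'[X]) : WithTop (DegValue Γ) :=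
  (ν'.val f.leadingCoeff).map (degPair f.natDegree)

theorem degPair_le_iff {m n : ℕ} {a b : Γ} :
    degPair m a ≤ degPair n b ↔ n < m ∨ (m = n ∧ a ≤ b) := by
  rw [degPair, degPair, Prod.Lex.toLex_le_toLex]
  rfl

theorem degValFun_eq (ν' : AlgVal k A' Γ) {f : A'[X]} (hf : f ≠ 0) :
    ∃ a : Γ, ν'.val f.leadingCoeff = a ∧ degValFun ν' f = (degPair f.natDegree a : DegValue Γ) := by
  have h : ν'.val f.leadingCoeff ≠ ⊤ := fun h =>
    hf (Polynomial.leadingCoeff_eq_zero.1 (ν'.eq_zero_of_val_eq_top _ h))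
  obtain ⟨a, ha⟩ := WithTop.ne_top_iff_exists.1 h
  exact ⟨a, ha.symm, by rw [degValFun, ← ha, WithTop.map_coe]⟩

theorem degValFun_zero (ν' : AlgVal k A' Γ) : degValFun ν' 0 = ⊤ := by
  rw [degValFun, Polynomial.leadingCoeff_zero, ν'.val.map_zero, WithTop.map_top]

theorem le_degValFun_iff (ν' : AlgVal k A' Γ) (m : ℕ) (a : Γ) (f : A'[X]) :
    ((degPair m a : DegValue Γ) : WithTop (DegValue Γ)) ≤ degValFun ν' f ↔
      f.natDegree ≤ m ∧ (a : WithTop Γ) ≤ ν'.val (f.coeff m) := by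
  by_cases hf : f = 0
  · rw [hf, degValFun_zero]
    simp
  · obtain ⟨b, hb, hv⟩ := degValFun_eq ν' hf
    rw [hv, WithTop.coe_le_coe, degPair_le_iff]
    constructor
    · rintro (h | ⟨h, hab⟩)
      · refine ⟨h.le, ?_⟩
        rw [Polynomial.coeff_eq_zero_of_natDegree_lt h, ν'.val.map_zero]
        exact le_top
      · refine ⟨h.ge, ?_⟩
        rw [h, Polynomial.coeff_natDegree, hb]
        exact WithTop.coe_le_coe.2 hab
    · rintro ⟨h, hab⟩
      rcases h.lt_or_eq with h | h
      · exact Or.inl h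
      · refine Or.inr ⟨h.symm, ?_⟩
        rw [← h, Polynomial.coeff_natDegree, hb] at hab
        exact WithTop.coe_le_coe.1 hab

theorem degValFun_add (ν' : AlgVal k A' Γ) (f g : A'[X]) :
    min (degValFun ν' f) (degValFun ν' g) ≤ degValFun ν' (f + g) := by
  by_cases hf : f = 0
  · rw [hf, zero_add]
    exact min_le_right _ _
  by_cases hg : g = 0
  · rw [hg, add_zero]
    exact min_le_left _ _
  have key : ∀ f g : A'[X], f ≠ 0 → degValFun ν' f ≤ degValFun ν' g →
      degValFun ν' f ≤ degValFun ν' (f + g) := by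
    intro f g hf h
    obtain ⟨a, _, hv⟩ := degValFun_eq ν' hf
    have h1 := (le_degValFun_iff ν' f.natDegree a f).1 hv.ge
    rw [hv, le_degValFun_iff] at h ⊢
    refine ⟨(Polynomial.natDegree_add_le _ _).trans (max_le h1.1 h.1), ?_⟩
    rw [Polynomial.coeff_add]
    exact ν'.val.map_le_add h1.2 h.2
  rcases le_total (degValFun ν' f) (degValFun ν' g) with h | h
  · rw [min_eq_left h]
    exact key f g hf h
  · rw [min_eq_right h, add_comm]
    exact key g f hg h

theorem degValFun_mul [IsDomain A'] (ν' : AlgVal k A' Γ) (f g : A'[X]) :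
    degValFun ν' (f * g) = degValFun ν' f + degValFun ν' g := by
  by_cases hf : f = 0
  · rw [hf, zero_mul, degValFun_zero, WithTop.top_add]
  by_cases hg : g = 0
  · rw [hg, mul_zero, degValFun_zero, WithTop.add_top]
  obtain ⟨a, ha, hv⟩ := degValFun_eq ν' hf
  obtain ⟨b, hb, hw⟩ := degValFun_eq ν' hg
  rw [hv, hw, degValFun, Polynomial.leadingCoeff_mul, Polynomial.natDegree_mul hf hg,
    AddValuation.map_mul, ha, hb, ← WithTop.coe_add, WithTop.map_coe, ← WithTop.coe_add]
  rfl

/-- The valuation `ν : A ∖ {0} → ℕ × Γ` induced by `ν'` on `A = ⨁ Aᵢ`: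
`ν(f) = (m, ν'(f_m))` where `f_m ≠ 0` is the component of `f` of largest degree. -/
def inducedVal [IsDomain A'] (ν' : AlgVal k A' Γ) (𝒜 : ℕ → Submodule k A')
    [SetLike.GradedMonoid 𝒜] : AlgVal k (gradedAlgebra 𝒜) (DegValue Γ) where
  val := AddValuation.of (fun f => degValFun ν' (f : A'[X])) (degValFun_zero ν')
    (by
      change degValFun ν' 1 = 0
      rw [degValFun, Polynomial.leadingCoeff_one, ν'.val.map_one, Polynomial.natDegree_one]
      rfl)
    (fun f g => degValFun_add ν' f g) (fun f g => degValFun_mul ν' f g)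
  eq_zero_of_val_eq_top := fun f h => by
    by_contra hf
    have hf' : (f : A'[X]) ≠ 0 := fun h0 => hf (Subtype.ext h0)
    obtain ⟨a, _, hv⟩ := degValFun_eq ν' hf'
    exact WithTop.coe_ne_top (hv.symm.trans h)
  val_algebraMap := fun c hc => by
    change degValFun ν' (algebraMap k A'[X] c) = 0
    rw [degValFun, Polynomial.algebraMap_apply, Polynomial.leadingCoeff_C, Polynomial.natDegree_C,
      ν'.val_algebraMap c hc]
    rfl

/-- The Newton-Okounkov body `closure (conv {v(f) / i : i > 0, f ∈ Bᵢ ∖ {0}})` of a graded algebra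
with homogeneous pieces `Bᵢ`, for a map `v` on its nonzero elements with values in a real
vector space. -/
def newtonOkounkovBody {B E : Type*} [CommRing B] [Algebra k B] [AddCommGroup E] [Module ℝ E]
    [TopologicalSpace E] (piece : ℕ → Submodule k B) (v : B → E) : Set E :=
  closure (convexHull ℝ {p | ∃ i : ℕ, 0 < i ∧ ∃ f ∈ piece i, f ≠ 0 ∧ p = (i : ℝ)⁻¹ • v f})

end Graded

/-! ### The valuation `μ` on `R/I` -/

section Mu

variable {k : Type*} [Field k] {m : ℕ}

/-- The presentation map `π : k[x₁, …, x_m] → A`, `π(xᵢ) = gᵢ`. -/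
abbrev presentation {A : Type*} [CommRing A] [Algebra k A] (g : Fin m → A) :
    MvPolynomial (Fin m) k →ₐ[k] A :=
  MvPolynomial.aeval g

/-- The monomial order `ord` is induced by `ν` with tie-breaking monomial order `tie`:
`x^α > x^β` iff `ν(π(x^α)) ≺ ν(π(x^β))`, or `ν(π(x^α)) = ν(π(x^β))` and `x^α >' x^β`. -/
def IsInducedOrder {A Γ : Type*} [CommRing A] [Algebra k A]
    [AddCancelCommMonoid Γ] [LinearOrder Γ] [IsOrderedAddMonoid Γ]
    (ν : AlgVal k A Γ) (g : Fin m → A) (ord tie : MonomialOrder (Fin m)) : Prop :=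
  ∀ α β : Fin m →₀ ℕ, ord.toSyn β < ord.toSyn α ↔
    (ν.val (presentation (k := k) g (MvPolynomial.monomial α 1)) <
        ν.val (presentation (k := k) g (MvPolynomial.monomial β 1)) ∨
      (ν.val (presentation (k := k) g (MvPolynomial.monomial α 1)) =
        ν.val (presentation (k := k) g (MvPolynomial.monomial β 1)) ∧
        tie.toSyn β < tie.toSyn α))

variable (ord : MonomialOrder (Fin m)) (I : Ideal (MvPolynomial (Fin m) k))

/-- `x^α` is a standard monomial of `I`: no leading monomial of an element of `I` divides it. -/
def IsStandard (α : Fin m →₀ ℕ) : Prop :=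
  ∀ f ∈ I, f ≠ 0 → ¬ ord.degree f ≤ α

theorem exists_normalForm (q : MvPolynomial (Fin m) k ⧸ I) :
    ∃ f : MvPolynomial (Fin m) k, Ideal.Quotient.mk I f = q ∧
      ∀ α ∈ f.support, IsStandard ord I α := by
  obtain ⟨f, rfl⟩ := Ideal.Quotient.mk_surjective q
  obtain ⟨c, r, h1, -, h3⟩ := ord.div_set (B := {b | b ∈ I ∧ b ≠ 0})
    (fun b hb => (MonomialOrder.leadingCoeff_ne_zero_iff.2 hb.2).isUnit) f
  refine ⟨r, ?_, fun α hα b hb hb0 => h3 α hα b ⟨hb, hb0⟩⟩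
  rw [Ideal.Quotient.eq, ← neg_mem_iff, neg_sub, sub_eq_of_eq_add h1]
  rw [Finsupp.linearCombination_apply]
  exact sum_mem fun b _ => I.mul_mem_left _ b.2.1

theorem normalForm_unique {f g : MvPolynomial (Fin m) k}
    (hfg : Ideal.Quotient.mk I f = Ideal.Quotient.mk I g)
    (hf : ∀ α ∈ f.support, IsStandard ord I α) (hg : ∀ α ∈ g.support, IsStandard ord I α) :
    f = g := by
  classical
  by_contra hne
  have h0 : f - g ≠ 0 := sub_ne_zero.2 hne
  have hI : f - g ∈ I := Ideal.Quotient.eq.1 hfg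
  have hs := ord.degree_mem_support h0
  rcases Finset.mem_union.1 (MvPolynomial.support_sub _ f g hs) with h | h
  · exact hf _ h _ hI h0 le_rfl
  · exact hg _ h _ hI h0 le_rfl

/-- The normal form `f̃`: the unique representative of a class of `R/I` that is a linear combination
of standard monomials. -/
def normalForm (q : MvPolynomial (Fin m) k ⧸ I) : MvPolynomial (Fin m) k :=
  (exists_normalForm ord I q).choose

/-- An exponent vector as an element of `ℤ^m`. -/
def expVec (α : Fin m →₀ ℕ) : Fin m → ℤ := fun i => (α i : ℤ)

/-- The toric exponent `α₁ - α₂` of a polynomial with at least two terms, where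
`x^α₁ > x^α₂` are its two largest monomials. -/
def torexp (f : MvPolynomial (Fin m) k) : Fin m → ℤ :=
  expVec (ord.degree f) - expVec (ord.degree (f - ord.leadingTerm f))

/-- The lattice `K ⊆ ℤ^m` spanned by the toric exponents of the elements of `I` that have at
least two terms. -/
def latticeK : Submodule ℤ (Fin m → ℤ) :=
  Submodule.span ℤ {v | ∃ f ∈ I, f - ord.leadingTerm f ≠ 0 ∧ v = torexp ord f}

/-- `torfree(ℤ^m / K)`, the quotient of `ℤ^m / K` by its torsion. -/
abbrev TorFree (K : Submodule ℤ (Fin m → ℤ)) : Type :=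
  ((Fin m → ℤ) ⧸ K) ⧸ Submodule.torsion ℤ ((Fin m → ℤ) ⧸ K)

/-- The image in `torfree(ℤ^m / K)` of a vector of `ℤ^m`. -/
def toTorFree (K : Submodule ℤ (Fin m → ℤ)) : (Fin m → ℤ) →ₗ[ℤ] TorFree K :=
  (Submodule.torsion ℤ ((Fin m → ℤ) ⧸ K)).mkQ ∘ₗ K.mkQ

/-- `μ([f])` is the image of `-exponent(leading monomial of f̃)` in `torfree(ℤ^m / K)`. It is only
meaningful for `[f] ≠ 0`. -/
def mu (q : MvPolynomial (Fin m) k ⧸ I) : TorFree (latticeK ord I) :=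
  toTorFree (latticeK ord I) (-expVec (ord.degree (normalForm ord I q)))

/-! ### Coordinates -/

/-- The inclusion `ℤ^m → ℚ^m`. -/
def ratVec : (Fin m → ℤ) →ₗ[ℤ] (Fin m → ℚ) :=
  (Int.castAddHom ℚ).toIntLinearMap.compLeft (Fin m)

/-- A basis `w₁, …, w_m` of `ℚ^m` adapted to `K` and `d` (here `m = ℓ + n + 1`):
`w₁, …, w_ℓ` (indexed by `Sum.inl`) is a lattice basis of `K`, `w_{ℓ+1} = d`, and
`w_{ℓ+2}, …, w_m` are vectors in `ℤ^m` orthogonal to `d`. -/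
structure AdaptedBasis (K : Submodule ℤ (Fin m → ℤ)) (d : Fin m → ℕ) (ℓ n : ℕ) where
  w : Module.Basis (Fin ℓ ⊕ Fin (n + 1)) ℚ (Fin m → ℚ)
  latticeBasis : Module.Basis (Fin ℓ) ℤ K
  w_inl : ∀ i, w (Sum.inl i) = ratVec (latticeBasis i : Fin m → ℤ)
  w_zero : w (Sum.inr 0) = fun i => (d i : ℚ)
  w_integral : ∀ j, ∃ z : Fin m → ℤ, w (Sum.inr j) = ratVec z
  w_orth : ∀ j, j ≠ 0 → w (Sum.inr j) ⬝ᵥ w (Sum.inr 0) = 0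

namespace AdaptedBasis

variable {K : Submodule ℤ (Fin m → ℤ)} {d : Fin m → ℕ} {ℓ n : ℕ} (W : AdaptedBasis K d ℓ n)

/-- The coordinates of a vector of `ℤ^m` with respect to `w_{ℓ+1}, …, w_m`. -/
def coords : (Fin m → ℤ) →ₗ[ℤ] (Fin (n + 1) → ℚ) where
  toFun v := fun j => W.w.repr (ratVec v) (Sum.inr j)
  map_add' v v' := by
    funext j
    simp
  map_smul' c v := by
    funext j
    rw [map_smul, ← Int.cast_smul_eq_zsmul ℚ, map_smul]
    simp

theorem latticeK_le_ker : K ≤ LinearMap.ker W.coords := by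
  intro v hv
  have h : ∀ x : K, W.coords (x : Fin m → ℤ) = 0 := by
    intro x
    have : W.coords ∘ₗ K.subtype = 0 := by
      refine W.latticeBasis.ext fun i => ?_
      funext j
      simp [coords, ← W.w_inl i]
    exact LinearMap.congr_fun this x
  exact h ⟨v, hv⟩

/-- The coordinates on `ℤ^m / K`. -/
def coordsQuot : ((Fin m → ℤ) ⧸ K) →ₗ[ℤ] (Fin (n + 1) → ℚ) :=
  K.liftQ W.coords W.latticeK_le_ker

theorem torsion_le_ker :
    Submodule.torsion ℤ ((Fin m → ℤ) ⧸ K) ≤ LinearMap.ker W.coordsQuot := by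
  intro x hx
  obtain ⟨a, ha⟩ := (Submodule.mem_torsion_iff x).1 hx
  have h : (a : ℤ) • W.coordsQuot x = 0 := by
    rw [← map_smul]
    have : (a : ℤ) • x = 0 := ha
    rw [this, map_zero]
  exact (smul_eq_zero.1 h).resolve_left (nonZeroDivisors.coe_ne_zero a)

/-- The coordinates on `torfree(ℤ^m / K)`: the class of `v` goes to the coordinates of `v` with
respect to `w_{ℓ+1}, …, w_m`. -/
def coordsTorFree : TorFree K →ₗ[ℤ] (Fin (n + 1) → ℚ) :=
  (Submodule.torsion ℤ ((Fin m → ℤ) ⧸ K)).liftQ W.coordsQuot W.torsion_le_ker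

/-- The embedding of `torfree(ℤ^m / K)` in `ℝ^{m-ℓ}` that represents `μ`. Since `μ([x^α])` is the
class of `-α` for a standard monomial `x^α`, the class of `-α` is sent to the coordinates of `α`,
so that `μ([x^α])` is represented by the coordinates of `α`. -/
def represent (a : TorFree K) : Fin (n + 1) → ℝ :=
  fun j => ((W.coordsTorFree (-a) j : ℚ) : ℝ)

end AdaptedBasis

/-- `μ` in the coordinates of an adapted basis. -/
def muCoord {d : Fin m → ℕ} {ℓ n : ℕ} (W : AdaptedBasis (latticeK ord I) d ℓ n)
    (q : MvPolynomial (Fin m) k ⧸ I) : Fin (n + 1) → ℝ :=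
  W.represent (mu ord I q)

/-- The degree `i` piece of `R/I`, where `deg xⱼ = dⱼ`. -/
def quotientPiece (d : Fin m → ℕ) (i : ℕ) : Submodule k (MvPolynomial (Fin m) k ⧸ I) :=
  (MvPolynomial.weightedHomogeneousSubmodule k d i).map (Ideal.Quotient.mkₐ k I).toLinearMap

end Mu

end KhovanskiiBasis

end

namespace KhovanskiiBasis

open MvPolynomial

/-! ### Linear algebra of adapted bases -/

section LinearAlgebra

variable {m : ℕ}

/-! Everything rests on the orthogonality of `K` to `d` (`dotForm_latticeK`). The presentation is
graded, so its kernel `I` is homogeneous; products of the nonzero `g i` in a domain are nonzero, so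
`I` contains no monomial; and higher degree means smaller value, so the induced order refines the
weighted degree. Hence the degree component of `f ∈ I` through its leading monomial has a second
term, and the two largest monomials of `f` have the same degree.

Orthogonality makes adapted bases exist and identifies the first coordinate of an exponent `α` as
its weighted degree divided by `‖d‖²` (`AdaptedBasis.dotForm_eq`). In particular `‖d‖² μ([x_i])_1 =
d i`, so the claimed vertices are `μ([x_i]) / d i`.

The coordinates kill `K`, and a monomial differs from the leading monomial of its normal form by an
element of `K` (`expVec_sub_mem_latticeK`). Thus `μ([x_i])` is the coordinate vector of the unit
vector `e_i` even when `x_i` is not standard. If `q` is homogeneous of degree `s` with normal form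
led by `x^α`, then `α` has weight `s`, and `μ(q) / s` is the convex combination of the `μ([x_i]) / d
i` with weights `α i * d i / s`. Conversely `[x_i]` itself lies in degree `d i`. A convex hull of
finitely many points is closed, so the closure adds nothing. -/

theorem ratVec_apply (v : Fin m → ℤ) (i : Fin m) : ratVec v i = (v i : ℚ) := rfl

theorem ratVec_injective : Function.Injective (ratVec (m := m)) := fun v w h => by
  funext i
  exact Int.cast_injective (α := ℚ) (congrFun h i)

/-- The linear form `v ↦ v ⬝ᵥ d` on `ℚ^m`. -/
noncomputable def dotForm (d : Fin m → ℕ) : (Fin m → ℚ) →ₗ[ℚ] ℚ :=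
  ∑ i, (d i : ℚ) • LinearMap.proj i

theorem dotForm_apply (d : Fin m → ℕ) (v : Fin m → ℚ) : dotForm d v = ∑ i, (d i : ℚ) * v i := by
  simp [dotForm]

theorem dotForm_expVec (d : Fin m → ℕ) (α : Fin m →₀ ℕ) :
    dotForm d (ratVec (expVec α)) = (Finsupp.weight d α : ℕ) := by
  simp [dotForm_apply, ratVec_apply, expVec, Finsupp.weight_eq_sum, mul_comm]

theorem dotForm_self_pos {d : Fin m → ℕ} (hd : ∀ i, 0 < d i) (hm : 0 < m) :
    0 < dotForm d fun i => (d i : ℚ) := by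
  rw [dotForm_apply]
  have : Nonempty (Fin m) := ⟨⟨0, hm⟩⟩
  exact Finset.sum_pos (fun i _ => mul_pos (Nat.cast_pos.2 (hd i)) (Nat.cast_pos.2 (hd i)))
    Finset.univ_nonempty

theorem exists_ne_zero_smul_eq_ratVec (v : Fin m → ℚ) :
    ∃ a : ℚ, a ≠ 0 ∧ ∃ z : Fin m → ℤ, a • v = ratVec z := by
  obtain ⟨b, hb⟩ := IsLocalization.exist_integer_multiples_of_finite (nonZeroDivisors ℤ) v
  choose z hz using hb
  refine ⟨((b : ℤ) : ℚ), Int.cast_ne_zero.2 (nonZeroDivisors.coe_ne_zero b), z, ?_⟩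
  funext i
  simpa [ratVec_apply] using (hz i).symm

/-- A lattice orthogonal to a positive vector `d` has an adapted basis. -/
theorem exists_adaptedBasis {K : Submodule ℤ (Fin m → ℤ)} {d : Fin m → ℕ} (hd : ∀ i, 0 < d i)
    (hm : 0 < m) (hK : ∀ v ∈ K, dotForm d (ratVec v) = 0) :
    ∃ ℓ n : ℕ, Nonempty (AdaptedBasis K d ℓ n) := by
  classical
  -- This is where `m > 0` enters: `d` has to be a nonzero vector to belong to a basis.
  have hdd := dotForm_self_pos hd hm
  obtain ⟨ℓ, ⟨b⟩⟩ : ∃ ℓ, Nonempty (Module.Basis (Fin ℓ) ℤ K) :=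
    ⟨_, ⟨Module.finBasis ℤ K⟩⟩
  -- The lattice basis is extended inside the hyperplane orthogonal to `d`, so the added vectors are
  -- automatically orthogonal to `d`; `d` itself is adjoined last.
  let H := LinearMap.ker (dotForm d)
  let v : Fin ℓ → H := fun i => ⟨ratVec (b i : Fin m → ℤ), hK _ (b i).2⟩
  have hv : LinearIndependent ℚ v := by
    refine LinearIndependent.of_comp H.subtype ?_
    -- Independence over `ℤ` persists over the fraction field.
    rw [← LinearIndependent.iff_fractionRing ℤ ℚ]
    exact b.linearIndependent.map' (ratVec ∘ₗ K.subtype) (LinearMap.ker_eq_bot.2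
      (ratVec_injective.comp Subtype.val_injective))
  let c := Module.Basis.sumExtend hv
  have : Finite (Fin ℓ ⊕ Module.Basis.sumExtendIndex hv) := Module.Finite.finite_basis c
  have : Finite (Module.Basis.sumExtendIndex hv) := Finite.sum_right (Fin ℓ)
  obtain ⟨n, ⟨e⟩⟩ := Finite.exists_equiv_fin (Module.Basis.sumExtendIndex hv)
  choose a ha z hz using fun j : Fin n =>
    exists_ne_zero_smul_eq_ratVec (c (Sum.inr (e.symm j)) : Fin m → ℚ)
  have hcl : ∀ i, c (Sum.inl i) = v i := fun i => by
    simp only [c, Module.Basis.sumExtend, Module.Basis.reindex_apply, Module.Basis.coe_extend]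
    rfl
  -- Denominators are cleared on the added vectors only; the factor 1 keeps the lattice basis of `K`
  -- intact.
  let c' := (c.reindex ((Equiv.refl (Fin ℓ)).sumCongr e)).unitsSMul
    (Sum.elim (fun _ => 1) fun j => Units.mk0 (a j) (ha j))
  have hl : ∀ i, c' (Sum.inl i) = v i := fun i => by
    simp [c', Module.Basis.unitsSMul_apply, hcl]
  have hr : ∀ j, (c' (Sum.inr j) : Fin m → ℚ) = ratVec (z j) := fun j => by
    simp [c', Module.Basis.unitsSMul_apply, ← hz, Units.smul_def]
  let w : Fin ℓ ⊕ Fin (n + 1) → Fin m → ℚ :=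
    Sum.elim (fun i => c' (Sum.inl i)) (Fin.cons (fun i => (d i : ℚ)) fun j => c' (Sum.inr j))
  have hw : LinearIndependent ℚ w := by
    rw [Fintype.linearIndependent_iff]
    intro s hs
    have h1 : s (Sum.inr 0) • (fun i => (d i : ℚ)) +
        ((∑ i, Sum.elim (fun i => s (Sum.inl i)) (fun j => s (Sum.inr (Fin.succ j))) i • c' i : H) :
          Fin m → ℚ) = 0 := by
      rw [← hs]
      simp [Fintype.sum_sum_type, Fin.sum_univ_succ, w]
      abel
    -- Pairing with `d` annihilates the part in `H` and leaves the coefficient of `d` times `‖d‖²`.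
    have h2 := congrArg (dotForm d) h1
    rw [map_add, map_smul, map_zero, LinearMap.mem_ker.1 (Subtype.prop _), add_zero,
      smul_eq_mul, mul_eq_zero, or_iff_left hdd.ne'] at h2
    rw [h2, zero_smul, zero_add, Submodule.coe_eq_zero] at h1
    have h3 := Fintype.linearIndependent_iff.1 c'.linearIndependent _ h1
    rintro (i | j)
    · exact h3 (Sum.inl i)
    · refine Fin.cases h2 (fun j => ?_) j
      exact h3 (Sum.inr j)
  have hcard : Fintype.card (Fin ℓ ⊕ Fin (n + 1)) = Module.finrank ℚ (Fin m → ℚ) := by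
    have h1 : Module.finrank ℚ H = ℓ + n := by
      rw [Module.finrank_eq_card_basis c']
      simp
    have h2 : Module.finrank ℚ (LinearMap.range (dotForm d)) = 1 := by
      rw [LinearMap.range_eq_top.2 (LinearMap.surjective fun h => hdd.ne' (by rw [h]; rfl)),
        finrank_top, Module.finrank_self]
    rw [← (dotForm d).finrank_range_add_finrank_ker, h2, h1]
    simp
    ring
  have : Nonempty (Fin ℓ ⊕ Fin (n + 1)) := ⟨Sum.inr 0⟩
  have hcoe := coe_basisOfLinearIndependentOfCardEqFinrank hw hcard
  exact ⟨ℓ, n, ⟨{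
    w := basisOfLinearIndependentOfCardEqFinrank hw hcard
    latticeBasis := b
    w_inl := fun i => by
      rw [hcoe]
      exact congrArg Subtype.val (hl i)
    w_zero := by
      rw [hcoe]
      rfl
    w_integral := fun j => by
      rw [hcoe]
      refine Fin.cases ⟨fun i => (d i : ℤ), ?_⟩ (fun j => ⟨z j, hr j⟩) j
      funext i
      simp [w, ratVec_apply]
    w_orth := fun j hj => by
      rw [hcoe]
      obtain ⟨j, rfl⟩ := Fin.exists_succ_eq.2 hj
      have h : dotForm d (c' (Sum.inr j) : Fin m → ℚ) = 0 := LinearMap.mem_ker.1 (c' _).2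
      rw [dotForm_apply] at h
      simpa [dotProduct, w, mul_comm] using h }⟩⟩

/-- If `K` is orthogonal to `d`, the first coordinate of `v` is `(v ⬝ᵥ d) / ‖d‖²`. -/
theorem AdaptedBasis.dotForm_eq {K : Submodule ℤ (Fin m → ℤ)} {d : Fin m → ℕ} {ℓ n : ℕ}
    (W : AdaptedBasis K d ℓ n) (hK : ∀ v ∈ K, dotForm d (ratVec v) = 0) (v : Fin m → ℤ) :
    dotForm d (ratVec v) = (dotForm d fun i => (d i : ℚ)) * W.coords v 0 := by
  -- Both linear forms vanish on every basis vector other than `d`, and they agree on `d`.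
  have h : dotForm d = (dotForm d fun i => (d i : ℚ)) • W.w.coord (Sum.inr 0) := by
    refine W.w.ext fun i => ?_
    rcases i with i | j
    · rw [LinearMap.smul_apply, Module.Basis.coord_apply, Module.Basis.repr_self, W.w_inl,
        hK _ (W.latticeBasis i).2, Finsupp.single_eq_of_ne (by simp), smul_zero]
    · by_cases hj : j = 0
      · simp [hj, ← W.w_zero]
      · have h := W.w_orth j hj
        rw [W.w_zero] at h
        have h' : dotForm d (W.w (Sum.inr j)) = 0 := by
          rw [dotForm_apply, ← h, dotProduct]
          exact Finset.sum_congr rfl fun i _ => mul_comm _ _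
        simp [h', hj]
  exact LinearMap.congr_fun h (ratVec v)

/-- Coordinates of exponent vectors are linear combinations of those of the unit vectors. -/
theorem AdaptedBasis.coords_expVec {K : Submodule ℤ (Fin m → ℤ)} {d : Fin m → ℕ} {ℓ n : ℕ}
    (W : AdaptedBasis K d ℓ n) (α : Fin m →₀ ℕ) (j : Fin (n + 1)) :
    W.coords (expVec α) j = ∑ i, (α i : ℚ) * W.coords (expVec (Finsupp.single i 1)) j := by
  classical
  have h : expVec α = ∑ i, α i • expVec (Finsupp.single i 1) := by
    funext j
    simp [expVec, Finset.sum_apply, Finsupp.single_apply]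
  conv_lhs => rw [h]
  rw [map_sum, Finset.sum_apply]
  refine Finset.sum_congr rfl fun i _ => ?_
  rw [map_nsmul, Pi.smul_apply, nsmul_eq_mul]

end LinearAlgebra

/-! ### Normal forms and the lattice `K` -/

section NormalForm

variable {k : Type*} [Field k] {m : ℕ} (ord : MonomialOrder (Fin m))
  (I : Ideal (MvPolynomial (Fin m) k))

theorem mk_normalForm (q : MvPolynomial (Fin m) k ⧸ I) :
    Ideal.Quotient.mk I (normalForm ord I q) = q :=
  (exists_normalForm ord I q).choose_spec.1

theorem isStandard_of_mem_support_normalForm (q : MvPolynomial (Fin m) k ⧸ I) :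
    ∀ α ∈ (normalForm ord I q).support, IsStandard ord I α :=
  (exists_normalForm ord I q).choose_spec.2

theorem normalForm_ne_zero {q : MvPolynomial (Fin m) k ⧸ I} (hq : q ≠ 0) :
    normalForm ord I q ≠ 0 := fun h => hq (by rw [← mk_normalForm ord I q, h, map_zero])

theorem normalForm_eq {f : MvPolynomial (Fin m) k} (hf : ∀ α ∈ f.support, IsStandard ord I α) :
    normalForm ord I (Ideal.Quotient.mk I f) = f :=
  normalForm_unique ord I (mk_normalForm ord I _)
    (isStandard_of_mem_support_normalForm ord I _) hf

/-- A monomial and the leading monomial of its normal form differ by an element of `K`. -/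
theorem expVec_sub_mem_latticeK {α : Fin m →₀ ℕ}
    (hα : Ideal.Quotient.mk I (monomial α (1 : k)) ≠ 0) :
    expVec α - expVec (ord.degree (normalForm ord I (Ideal.Quotient.mk I (monomial α (1 : k))))) ∈
      latticeK ord I := by
  classical
  set p := normalForm ord I (Ideal.Quotient.mk I (monomial α (1 : k))) with hp
  have hp0 : p ≠ 0 := normalForm_ne_zero ord I hα
  by_cases hs : IsStandard ord I α
  · have : p = monomial α 1 := normalForm_eq ord I fun β hβ => by
      rw [Finset.mem_singleton.1 (support_monomial_subset hβ)]
      exact hs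
    rw [this, ord.degree_monomial, if_neg one_ne_zero, sub_self]
    exact zero_mem _
  -- For nonstandard `α` this element of `I` realizes the difference as a toric exponent. Its
  -- leading monomial cannot come from `p`, whose monomials are all standard, so it is `x^α`; what
  -- remains is `-p`, nonzero because the class of `x^α` is.
  · set f := monomial α (1 : k) - p with hf
    have hfI : f ∈ I := by
      rw [← Ideal.Quotient.eq, hp, mk_normalForm]
    have hαp : α ∉ p.support := fun h => hs (isStandard_of_mem_support_normalForm ord I _ α h)
    have hf0 : f ≠ 0 := fun h => hαp (by
      rw [← sub_eq_zero.1 h]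
      simp)
    have hdeg : ord.degree f = α := by
      by_contra hne
      have h1 := ord.degree_mem_support hf0
      have h2 : ord.degree f ∈ p.support := by
        rw [mem_support_iff] at h1 ⊢
        rw [hf, coeff_sub, coeff_monomial, if_neg (Ne.symm hne), zero_sub] at h1
        exact neg_ne_zero.1 h1
      exact isStandard_of_mem_support_normalForm ord I _ _ h2 f hfI hf0 le_rfl
    have hlc : ord.leadingCoeff f = 1 := by
      rw [MonomialOrder.leadingCoeff, hdeg, hf, coeff_sub, coeff_monomial, if_pos rfl,
        notMem_support_iff.1 hαp, sub_zero]
    have hsub : f - ord.leadingTerm f = -p := by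
      rw [MonomialOrder.leadingTerm, hdeg, hlc, hf]
      ring
    refine Submodule.subset_span ⟨f, hfI, ?_, ?_⟩
    · rw [hsub]
      exact neg_ne_zero.2 hp0
    · rw [torexp, hsub, hdeg, ord.degree_neg]

/-- The sign in `mu` and the sign in `represent` cancel, and the lift of the coordinates through
both quotients computes definitionally. -/
theorem muCoord_apply {d : Fin m → ℕ} {ℓ n : ℕ} (W : AdaptedBasis (latticeK ord I) d ℓ n)
    (q : MvPolynomial (Fin m) k ⧸ I) (j : Fin (n + 1)) :
    muCoord ord I W q j = (W.coords (expVec (ord.degree (normalForm ord I q))) j : ℝ) := by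
  have h : ∀ v, W.coordsTorFree (toTorFree _ v) = W.coords v := fun v => rfl
  rw [muCoord, AdaptedBasis.represent, mu, ← map_neg, neg_neg, h]

/-- The variable need not be standard: replacing it by its normal form changes the leading exponent
by an element of `K`, which the coordinates do not see. -/
theorem muCoord_X {d : Fin m → ℕ} {ℓ n : ℕ} (W : AdaptedBasis (latticeK ord I) d ℓ n)
    {i : Fin m} (hi : Ideal.Quotient.mk I (X i) ≠ 0) (j : Fin (n + 1)) :
    muCoord ord I W (Ideal.Quotient.mk I (X i)) j =
      (W.coords (expVec (Finsupp.single i 1)) j : ℝ) := by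
  rw [muCoord_apply]
  have h := W.latticeK_le_ker (expVec_sub_mem_latticeK ord I (α := Finsupp.single i 1) hi)
  rw [LinearMap.mem_ker, map_sub, sub_eq_zero] at h
  rw [h]
  rfl

variable {I}

/-- The normal form of a homogeneous class of a homogeneous ideal is homogeneous. -/
theorem weight_eq_of_mem_support_normalForm {d : Fin m → ℕ}
    (hI : ∀ f ∈ I, ∀ s, weightedHomogeneousComponent d s f ∈ I) {s : ℕ}
    {q : MvPolynomial (Fin m) k ⧸ I} (hq : q ∈ quotientPiece I d s) {α : Fin m →₀ ℕ}
    (hα : α ∈ (normalForm ord I q).support) : Finsupp.weight d α = s := by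
  classical
  obtain ⟨f, hf, rfl⟩ := hq
  set p := normalForm ord I ((Ideal.Quotient.mkₐ k I).toLinearMap f) with hp
  -- The degree `s` component of `p` represents the same class, as `I` is homogeneous, and is still
  -- supported on standard monomials; uniqueness of normal forms applies.
  have h : weightedHomogeneousComponent d s p = p := by
    refine normalForm_unique ord I ?_ (fun β hβ => ?_)
      (isStandard_of_mem_support_normalForm ord I _)
    · have h1 : p - f ∈ I := by
        rw [← Ideal.Quotient.eq, hp, mk_normalForm]
        rfl
      have h2 := hI _ h1 s
      rw [map_sub, weightedHomogeneousComponent_eq_self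
        ((mem_weightedHomogeneousSubmodule _ _ _ _).1 hf), ← Ideal.Quotient.eq] at h2
      rw [h2, ← Ideal.Quotient.eq.2 h1]
    · refine isStandard_of_mem_support_normalForm ord I
        ((Ideal.Quotient.mkₐ k I).toLinearMap f) β ?_
      rw [mem_support_iff, coeff_weightedHomogeneousComponent] at hβ
      exact mem_support_iff.2 fun h0 => hβ (by rw [hp, h0, ite_self])
  by_contra hne
  rw [← h, mem_support_iff, coeff_weightedHomogeneousComponent, if_neg hne] at hα
  exact hα rfl

/-- `K` is orthogonal to `d` if `I` is homogeneous and contains no monomial, and the monomial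
order refines the weighted degree. -/
theorem dotForm_latticeK {d : Fin m → ℕ}
    (hI : ∀ f ∈ I, ∀ s, weightedHomogeneousComponent d s f ∈ I)
    (hmon : ∀ α, monomial α (1 : k) ∉ I)
    (hord : ∀ α β, ord.toSyn β ≤ ord.toSyn α → Finsupp.weight d β ≤ Finsupp.weight d α) :
    ∀ v ∈ latticeK ord I, dotForm d (ratVec v) = 0 := by
  classical
  have h : latticeK ord I ≤ LinearMap.ker ((dotForm d).restrictScalars ℤ ∘ₗ ratVec) := by
    refine Submodule.span_le.2 ?_
    rintro _ ⟨f, hf, hne, rfl⟩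
    set γ := ord.degree (f - ord.leadingTerm f) with hγ
    have hf0 : f ≠ 0 := by
      rintro rfl
      simp at hne
    suffices h : Finsupp.weight d (ord.degree f) = Finsupp.weight d γ by
      change dotForm d (ratVec (expVec _ - expVec _)) = 0
      rw [map_sub, map_sub, dotForm_expVec, dotForm_expVec, h, sub_self]
    refine le_antisymm ?_ (hord _ _ (ord.degree_sub_leadingTerm_le f))
    set s := Finsupp.weight d (ord.degree f) with hs
    set F := weightedHomogeneousComponent d s f with hF
    have hFI : F ∈ I := hI f hf s
    have hFc : F.coeff (ord.degree f) = ord.leadingCoeff f := by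
      rw [hF, coeff_weightedHomogeneousComponent, if_pos rfl]
      rfl
    -- If `F` had no second term, dividing by its coefficient would put a monomial in `I`. The
    -- exponent `β` found here has weight `s` and occurs in `f` minus its leading term, so `β` is at
    -- most `γ` and `γ` has weight at least `s`.
    obtain ⟨β, hβF, hβ⟩ : ∃ β ∈ F.support, β ≠ ord.degree f := by
      by_contra! hcon
      refine hmon (ord.degree f) ?_
      have hFm : F = C (ord.leadingCoeff f) * monomial (ord.degree f) 1 := by
        ext β
        rw [coeff_C_mul, coeff_monomial]
        split_ifs with h
        · rw [← h, hFc, mul_one]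
        · rw [mul_zero]
          by_contra h0
          exact h (hcon β (mem_support_iff.2 h0)).symm
      have h := I.mul_mem_left (C (ord.leadingCoeff f)⁻¹) (hFm ▸ hFI)
      rwa [← mul_assoc, ← C_mul, inv_mul_cancel₀ (ord.leadingCoeff_ne_zero_iff.2 hf0), C_1,
        one_mul] at h
    rw [mem_support_iff, hF, coeff_weightedHomogeneousComponent] at hβF
    have hw : Finsupp.weight d β = s := by
      by_contra hne
      exact hβF (if_neg hne)
    rw [if_pos hw] at hβF
    have hβγ : β ∈ (f - ord.leadingTerm f).support := by
      rw [mem_support_iff, coeff_sub, MonomialOrder.leadingTerm, coeff_monomial,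
        if_neg (Ne.symm hβ), sub_zero]
      exact hβF
    rw [← hw]
    exact hord _ _ (ord.le_degree hβγ)
  exact fun v hv => h hv

end NormalForm

/-! ### The kernel of the presentation -/

section Presentation

variable {k A' Γ : Type*} [Field k] [CommRing A'] [Algebra k A']
  [AddCommGroup Γ] [LinearOrder Γ] [IsOrderedAddMonoid Γ]
  {𝒜 : ℕ → Submodule k A'} [SetLike.GradedMonoid 𝒜] {m : ℕ}
  {g : Fin m → gradedAlgebra 𝒜} {d : Fin m → ℕ}

theorem coe_presentation_monomial (hgd : ∀ i, IsHomogeneousOfDegree 𝒜 (d i) (g i))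
    (α : Fin m →₀ ℕ) (a : k) :
    ∃ c, (presentation (k := k) g (monomial α a) : A'[X]) =
      Polynomial.monomial (Finsupp.weight d α) c := by
  choose c _ hc using hgd
  refine ⟨a • ∏ i, c i ^ α i, ?_⟩
  have h : ∀ s : Finset (Fin m), ∏ i ∈ s, ((g i : A'[X]) ^ α i) =
      Polynomial.monomial (∑ i ∈ s, α i • d i) (∏ i ∈ s, c i ^ α i) := by
    classical
    intro s
    induction s using Finset.induction_on with
    | empty => simp
    | insert i s hi ih =>
      rw [Finset.prod_insert hi, Finset.sum_insert hi, Finset.prod_insert hi, ih, hc,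
        Polynomial.monomial_pow, Polynomial.monomial_mul_monomial, smul_eq_mul, mul_comm (d i)]
  rw [presentation, aeval_monomial, ← Algebra.smul_def, Finsupp.prod_fintype _ _ (by simp),
    Finsupp.weight_eq_sum, ← Polynomial.smul_monomial, ← h]
  simp

/-- The presentation is graded: by linearity it suffices to look at monomials, whose images are
concentrated in the degree given by their weight. -/
theorem coe_presentation_weightedHomogeneousComponent
    (hgd : ∀ i, IsHomogeneousOfDegree 𝒜 (d i) (g i)) (s : ℕ) (f : MvPolynomial (Fin m) k) :
    (presentation (k := k) g (weightedHomogeneousComponent d s f) : A'[X]) =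
      Polynomial.monomial s ((presentation (k := k) g f : A'[X]).coeff s) := by
  classical
  induction f using MvPolynomial.induction_on' with
  | monomial α a =>
    obtain ⟨c, hc⟩ := coe_presentation_monomial (k := k) hgd α a
    rw [weightedHomogeneousComponent_of_mem (isWeightedHomogeneous_monomial d α a rfl), hc,
      Polynomial.coeff_monomial]
    by_cases h : s = Finsupp.weight d α
    · rw [if_pos h, if_pos h.symm, hc, h]
    · rw [if_neg h, if_neg (Ne.symm h), map_zero, map_zero]
      rfl
  | add p q hp hq =>
    rw [map_add, map_add, map_add, Subalgebra.coe_add, Subalgebra.coe_add, hp, hq,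
      Polynomial.coeff_add, map_add]

theorem weightedHomogeneousComponent_mem_ker
    (hgd : ∀ i, IsHomogeneousOfDegree 𝒜 (d i) (g i)) {f : MvPolynomial (Fin m) k}
    (hf : f ∈ RingHom.ker (presentation (k := k) g)) (s : ℕ) :
    weightedHomogeneousComponent d s f ∈ RingHom.ker (presentation (k := k) g) := by
  rw [RingHom.mem_ker] at hf ⊢
  refine Subtype.ext ?_
  rw [coe_presentation_weightedHomogeneousComponent hgd, hf]
  simp

variable [IsDomain A']

/-- Since `A` is a domain, the kernel contains no monomial; this supplies the second term of
homogeneous components and makes each `[x_i]` nonzero. -/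
theorem presentation_monomial_ne_zero (hg : ∀ i, g i ≠ 0) (α : Fin m →₀ ℕ) :
    presentation (k := k) g (monomial α 1) ≠ 0 := by
  rw [presentation, aeval_monomial, map_one, one_mul, Finsupp.prod]
  exact Finset.prod_ne_zero_iff.2 fun i _ => pow_ne_zero _ (hg i)

/-- An order induced by `ν` refines the weighted degree. -/
theorem IsInducedOrder.weight_le {ν' : AlgVal k A' Γ}
    (hgd : ∀ i, IsHomogeneousOfDegree 𝒜 (d i) (g i)) (hg : ∀ i, g i ≠ 0)
    {ord tie : MonomialOrder (Fin m)} (hord : IsInducedOrder (inducedVal ν' 𝒜) g ord tie)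
    (α β : Fin m →₀ ℕ) (h : ord.toSyn β ≤ ord.toSyn α) :
    Finsupp.weight d β ≤ Finsupp.weight d α := by
  have hval : ∀ α : Fin m →₀ ℕ, ∃ a : Γ,
      (inducedVal ν' 𝒜).val (presentation (k := k) g (monomial α 1)) =
        ((degPair (Finsupp.weight d α) a : DegValue Γ) : WithTop (DegValue Γ)) := by
    intro α
    have h0 : (presentation (k := k) g (monomial α 1) : A'[X]) ≠ 0 := fun h =>
      presentation_monomial_ne_zero (k := k) hg α (Subtype.ext h)
    obtain ⟨c, hc⟩ := coe_presentation_monomial (k := k) hgd α 1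
    obtain ⟨a, -, ha⟩ := degValFun_eq ν' h0
    refine ⟨a, ha.trans ?_⟩
    have hc0 : c ≠ 0 := fun h => h0 (by rw [hc, h, map_zero])
    rw [hc, Polynomial.natDegree_monomial_eq _ hc0]
  by_contra! hlt
  -- The degree factor of the value group is reversed, so the larger weight of `β` gives a strictly
  -- smaller value and a strictly larger monomial; the tie-break plays no role.
  refine h.not_gt ((hord β α).2 (Or.inl ?_))
  obtain ⟨a, ha⟩ := hval α
  obtain ⟨b, hb⟩ := hval β
  rw [ha, hb, WithTop.coe_lt_coe, lt_iff_not_ge, degPair_le_iff]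
  rintro (h' | ⟨h', -⟩)
  · exact absurd h' hlt.not_gt
  · exact hlt.ne h'

end Presentation

end KhovanskiiBasis

/-! ### The Newton–Okounkov body as a polytope -/

theorem mainTheorem10 {k A' Γ : Type*} [Field k] [CommRing A'] [IsDomain A'] [Algebra k A']
    [AddCommGroup Γ] [LinearOrder Γ] [IsOrderedAddMonoid Γ]
    [Module.Free ℤ Γ] [Module.Finite ℤ Γ]
    (ν' : KhovanskiiBasis.AlgVal k A' Γ) (hν' : ν'.StandingHypotheses)
    (𝒜 : ℕ → Submodule k A') [SetLike.GradedMonoid 𝒜]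
    {m : ℕ} (g : Fin m → KhovanskiiBasis.gradedAlgebra 𝒜) (d : Fin m → ℕ)
    (hd : ∀ i, 0 < d i)
    (hgd : ∀ i, KhovanskiiBasis.IsHomogeneousOfDegree 𝒜 (d i) (g i))
    (hg : (KhovanskiiBasis.inducedVal ν' 𝒜).IsKhovanskiiBasis g)
    (ord tie : MonomialOrder (Fin m))
    (hord : KhovanskiiBasis.IsInducedOrder (KhovanskiiBasis.inducedVal ν' 𝒜) g ord tie)
    (I : Ideal (MvPolynomial (Fin m) k))
    (hI : I = RingHom.ker (KhovanskiiBasis.presentation (k := k) g)) :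
    (0 < m → ∃ ℓ n : ℕ,
      Nonempty (KhovanskiiBasis.AdaptedBasis (KhovanskiiBasis.latticeK ord I) d ℓ n)) ∧
    ∀ (ℓ n : ℕ) (W : KhovanskiiBasis.AdaptedBasis (KhovanskiiBasis.latticeK ord I) d ℓ n),
      (∀ i, KhovanskiiBasis.muCoord ord I W (Ideal.Quotient.mk I (MvPolynomial.X i)) 0 ≠ 0) ∧
      KhovanskiiBasis.newtonOkounkovBody (KhovanskiiBasis.quotientPiece I d)
          (KhovanskiiBasis.muCoord ord I W) =
        convexHull ℝ (Set.range fun i : Fin m =>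
          (‖WithLp.toLp 2 (fun j => (d j : ℝ))‖ ^ 2 *
              KhovanskiiBasis.muCoord ord I W (Ideal.Quotient.mk I (MvPolynomial.X i)) 0)⁻¹ •
            KhovanskiiBasis.muCoord ord I W (Ideal.Quotient.mk I (MvPolynomial.X i))) := by
  classical
  obtain ⟨hg0, -⟩ := hg
  have hhom : ∀ f ∈ I, ∀ s, MvPolynomial.weightedHomogeneousComponent d s f ∈ I := by
    rw [hI]
    exact fun f hf s => KhovanskiiBasis.weightedHomogeneousComponent_mem_ker hgd hf s
  have hmon : ∀ α, MvPolynomial.monomial α (1 : k) ∉ I := by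
    rw [hI]
    exact fun α => KhovanskiiBasis.presentation_monomial_ne_zero hg0 α
  have hK := KhovanskiiBasis.dotForm_latticeK ord hhom hmon (hord.weight_le hgd hg0)
  refine ⟨fun hm => KhovanskiiBasis.exists_adaptedBasis hd hm hK, fun ℓ n W => ?_⟩
  have hX : ∀ i, Ideal.Quotient.mk I (MvPolynomial.X i) ≠ 0 := fun i h =>
    hmon (Finsupp.single i 1) (Ideal.Quotient.eq_zero_iff_mem.1 h)
  set v : Fin m → Fin (n + 1) → ℝ := fun i =>
    KhovanskiiBasis.muCoord ord I W (Ideal.Quotient.mk I (MvPolynomial.X i)) with hv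
  -- Pairing the unit vector `e_i` with `d` gives `d i`, so the normalizing factor in the statement
  -- is just the degree of `x_i`.
  have hfirst : ∀ i, ‖WithLp.toLp 2 (fun j => (d j : ℝ))‖ ^ 2 * v i 0 = d i := by
    intro i
    have h := W.dotForm_eq hK (KhovanskiiBasis.expVec (Finsupp.single i 1))
    rw [KhovanskiiBasis.dotForm_expVec, Finsupp.weight_single, one_smul,
      KhovanskiiBasis.dotForm_apply] at h
    have h' := congrArg (Rat.cast (K := ℝ)) h
    push_cast at h'
    rw [hv, EuclideanSpace.real_norm_sq_eq]
    simp only [KhovanskiiBasis.muCoord_X ord I W (hX i)]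
    rw [h']
    simp [sq]
  have hdpos : ∀ i, (0 : ℝ) < d i := fun i => Nat.cast_pos.2 (hd i)
  refine ⟨fun i h => (hdpos i).ne' (by rw [← hfirst i, hv]; simp only [h, mul_zero]), ?_⟩
  have hset : (Set.range fun i : Fin m =>
      (‖WithLp.toLp 2 (fun j => (d j : ℝ))‖ ^ 2 * v i 0)⁻¹ • v i) =
        Set.range fun i => (d i : ℝ)⁻¹ • v i := by
    simp only [hfirst]
  change _ = convexHull ℝ (Set.range fun i : Fin m =>
      (‖WithLp.toLp 2 (fun j => (d j : ℝ))‖ ^ 2 * v i 0)⁻¹ • v i)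
  rw [hset, KhovanskiiBasis.newtonOkounkovBody]
  refine Eq.trans (congrArg closure ?_) ((Set.finite_range _).isClosed_convexHull ℝ).closure_eq
  refine Set.Subset.antisymm (convexHull_min ?_ (convex_convexHull ℝ _)) (convexHull_mono ?_)
  · rintro _ ⟨s, hs, q, hq, hq0, rfl⟩
    set α := ord.degree (KhovanskiiBasis.normalForm ord I q) with hα
    have hw : Finsupp.weight d α = s := KhovanskiiBasis.weight_eq_of_mem_support_normalForm ord
      hhom hq (ord.degree_mem_support (KhovanskiiBasis.normalForm_ne_zero ord I hq0))
    have hs' : (0 : ℝ) < s := Nat.cast_pos.2 hs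
    -- The weights `α i * d i / s` are nonnegative and sum to 1 because `α` has weighted degree `s`.
    have hcomb : (s : ℝ)⁻¹ • KhovanskiiBasis.muCoord ord I W q =
        ∑ i, ((s : ℝ)⁻¹ * (α i * d i)) • (d i : ℝ)⁻¹ • v i := by
      funext j
      rw [Pi.smul_apply, KhovanskiiBasis.muCoord_apply, ← hα, W.coords_expVec]
      simp only [Finset.sum_apply, Pi.smul_apply, smul_eq_mul, hv,
        KhovanskiiBasis.muCoord_X ord I W (hX _), Rat.cast_sum, Rat.cast_mul,
        Rat.cast_natCast, Finset.mul_sum]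
      refine Finset.sum_congr rfl fun i _ => ?_
      have := (hdpos i).ne'
      field_simp
    rw [hcomb]
    refine (convex_convexHull ℝ _).sum_mem (fun i _ => by positivity) ?_
      fun i _ => subset_convexHull ℝ _ ⟨i, rfl⟩
    rw [← Finset.mul_sum, inv_mul_eq_one₀ hs'.ne', ← hw, Finsupp.weight_eq_sum]
    simp
  · rintro _ ⟨i, rfl⟩
    exact ⟨d i, hd i, _, ⟨MvPolynomial.X i, MvPolynomial.isWeightedHomogeneous_X k d i, rfl⟩,
      hX i, rfl⟩
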